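/- Let $0 \le 2s \le n$, let $\mathbb{R}^n_s$ be $\mathbb{R}^n$ endowed with a non-degenerate symmetric bilinear form of signature $(n-s,s)$, and let $\mathrm{Iso}(\mathbb{R}^n_s)$ be its group of isometries, that is, the affine automorphisms of $\mathbb{R}^n$ whose linear part preserves the form. For a subgroup $\Gamma \subset \mathrm{Iso}(\mathbb{R}^n_s)$ let $\mathrm{Hol}(\Gamma)$ denote its linear holonomy group, the group of linear parts of the elements of $\Gamma$. Suppose that the centralizer of $\Gamma$ in $\mathrm{Iso}(\mathbb{R}^n_s)$ acts transitively on $\mathbb{R}^n_s$ and that $\mathrm{Hol}(\Gamma)$ is non-abelian. Then $$s \ge 7 \quad\text{and}\quad n \ge 14.$$ These bounds are sharp: there is a subgroup $\Gamma \subset \mathrm{Iso}(\mathbb{R}^{14}_7)$ whose centralizer in $\mathrm{Iso}(\mathbb{R}^{14}_7)$ acts transitively on $\mathbb{R}^{14}_7$ and whose linear holonomy group $\mathrm{Hol}(\Gamma)$ is non-abelian. -/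

import Mathlib

/-- The bilinear form `b` makes `ℝⁿ` into the space `ℝⁿ_s`: it is symmetric, non-degenerate and of
signature `(n - s, s)` (positive part first). -/
structure IsPseudoEuclidean {n : ℕ} (s : ℕ) (b : LinearMap.BilinForm ℝ (Fin n → ℝ)) : Prop where
  symm : b.IsSymm
  nondegenerate : b.Nondegenerate
  sigPos_eq : sigPos (LinearMap.BilinMap.toQuadraticMap b) = n - s
  sigNeg_eq : sigNeg (LinearMap.BilinMap.toQuadraticMap b) = s

/-- The isometry group `Iso(ℝⁿ_s)`: the affine automorphisms of `ℝⁿ` whose linear part preserves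
the bilinear form. -/
def Iso {n : ℕ} (b : LinearMap.BilinForm ℝ (Fin n → ℝ)) :
    Subgroup ((Fin n → ℝ) ≃ᵃ[ℝ] (Fin n → ℝ)) where
  carrier := {γ | ∀ x y, b (γ.linear x) (γ.linear y) = b x y}
  one_mem' := fun _ _ => rfl
  mul_mem' := fun {γ δ} hγ hδ x y => (hγ (δ.linear x) (δ.linear y)).trans (hδ x y)
  inv_mem' := fun {γ} hγ x y => by
    have h := hγ (γ.linear.symm x) (γ.linear.symm y)
    rw [LinearEquiv.apply_symm_apply, LinearEquiv.apply_symm_apply] at h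
    exact h.symm

/-- The centralizer of `Γ` in `Iso(ℝⁿ_s)` acts transitively on `ℝⁿ`. -/
def HasTransitiveCentralizer {n : ℕ} {b : LinearMap.BilinForm ℝ (Fin n → ℝ)}
    (Γ : Subgroup (Iso b)) : Prop :=
  ∀ x y : Fin n → ℝ, ∃ z ∈ Subgroup.centralizer (Γ : Set (Iso b)),
    (z : (Fin n → ℝ) ≃ᵃ[ℝ] (Fin n → ℝ)) x = y

/-- The linear holonomy group `Hol(Γ)`: the group of linear parts of the elements of `Γ`. -/
def Hol {n : ℕ} {b : LinearMap.BilinForm ℝ (Fin n → ℝ)} (Γ : Subgroup (Iso b)) :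
    Subgroup ((Fin n → ℝ) ≃ₗ[ℝ] (Fin n → ℝ)) :=
  Γ.map (AffineEquiv.linearHom.comp (Iso b).subtype)

/-- The linear holonomy group of `Γ` is not abelian. -/
def HasNonabelianHolonomy {n : ℕ} {b : LinearMap.BilinForm ℝ (Fin n → ℝ)}
    (Γ : Subgroup (Iso b)) : Prop :=
  ∃ g ∈ Hol Γ, ∃ h ∈ Hol Γ, g * h ≠ h * g

/-! An element of the centralizer carries the displacement `γ x - x = A x + v` of each `γ ∈ Γ` from
one point to another by a linear isometry. By transitivity, pairings of displacements are constant
in `x`. Their coefficients give that the `A` are skew, square to zero and anticommute, and that `A₁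
v₂ = -A₂ v₁`. Transitivity also makes `Γ` act freely.

Non-abelian holonomy means `A₁ A₂ ≠ 0`, and freeness puts `A₁ v₂` outside the range of `A₁ A₂`. From
this `exists_isotropic_submodule_finrank_eq_seven` builds a 7-dimensional isotropic subspace, so `s
≥ 7`. The example in signature `(7, 7)` realizes this configuration with nothing to spare. -/

open LinearMap (BilinForm)

/-! ### Linear algebra: the isotropic subspace. -/

/-- Two skew endomorphisms `A₁`, `A₂` of square zero with non-zero product, together with suitable
translation vectors `v₁`, `v₂`, force a seven-dimensional isotropic subspace. -/
theorem exists_isotropic_submodule_finrank_eq_seven {V : Type*} [AddCommGroup V]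
    [Module ℝ V] [FiniteDimensional ℝ V] (b : BilinForm ℝ V)
    (hb : b.IsSymm) (hnd : b.Nondegenerate) (A₁ A₂ : V →ₗ[ℝ] V) (v₁ v₂ : V)
    (skew₁ : ∀ x y, b (A₁ x) y = -b x (A₁ y)) (skew₂ : ∀ x y, b (A₂ x) y = -b x (A₂ y))
    (sq₁ : ∀ x, A₁ (A₁ x) = 0) (sq₂ : ∀ x, A₂ (A₂ x) = 0)
    (anti : ∀ x, A₂ (A₁ x) = -A₁ (A₂ x))
    (h₁₁ : A₁ v₁ = 0) (h₂₂ : A₂ v₂ = 0) (h₁₂ : A₂ v₁ = -A₁ v₂)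
    (free : ∀ t, A₁ (A₂ t) + A₁ v₂ ≠ 0) (hne : ∃ w, A₁ (A₂ w) ≠ 0) :
    ∃ N : Submodule ℝ V, Module.finrank ℝ N = 7 ∧ ∀ x ∈ N, b x x = 0 := by
  have symm : ∀ x y, b x y = b y x := fun x y => hb.eq x y
  have skew₁₂ : ∀ x y, b x (A₁ (A₂ y)) = -b y (A₁ (A₂ x)) := by
    intro x y
    have h := anti y
    rw [symm x, skew₁, skew₂, anti, map_neg]
    ring
  have sq₁₂ : ∀ x, b x (A₁ (A₂ x)) = 0 := fun x => by linarith [skew₁₂ x x]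
  obtain ⟨p, hp⟩ := hne
  obtain ⟨q, hpq⟩ : ∃ q, b q (A₁ (A₂ p)) ≠ 0 := by
    by_contra! h
    exact hp (hnd.2 _ h)
  have hqp : b p (A₁ (A₂ q)) = -b q (A₁ (A₂ p)) := skew₁₂ p q
  -- `A₁ A₂` is skew, so its kernel is the orthogonal complement of its range; `A₁ v₂` lies outside
  -- the range, hence is not orthogonal to the kernel.
  obtain ⟨x, hx, hxv⟩ : ∃ x, A₁ (A₂ x) = 0 ∧ b x (A₁ v₂) ≠ 0 := by
    by_contra! h
    have hmem : A₁ v₂ ∈ b.orthogonal (b.orthogonal (LinearMap.range (A₁ ∘ₗ A₂))) := by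
      intro y hy
      refine h y (hnd.2 _ fun z => ?_)
      rw [skew₁₂, neg_eq_zero]
      have := hy (A₁ (A₂ z)) ⟨z, rfl⟩
      exact (symm _ _).trans this
    rw [LinearMap.BilinForm.orthogonal_orthogonal hnd hb.isRefl] at hmem
    obtain ⟨t, ht⟩ := hmem
    refine free (-t) ?_
    rw [← ht]
    simp
  have hx' : ∀ y, b x (A₁ (A₂ y)) = 0 := fun y => by rw [skew₁₂, hx, map_zero, neg_zero]
  have hxv' : b v₂ (A₁ x) = -b x (A₁ v₂) := by rw [symm, skew₁]
  have hv : ∀ y, b v₁ (A₁ y) = 0 := fun y => by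
    rw [← neg_eq_zero, ← skew₁, h₁₁, map_zero, LinearMap.zero_apply]
  have hv' : ∀ y, b v₂ (A₂ y) = 0 := fun y => by
    rw [← neg_eq_zero, ← skew₂, h₂₂, map_zero, LinearMap.zero_apply]
  have hv₁ : ∀ y, b v₁ (A₂ y) = b y (A₁ v₂) := fun y => by
    rw [symm, skew₂, h₁₂, map_neg, neg_neg]
  have hvv : b v₂ (A₁ v₂) = 0 := by linarith [symm v₂ (A₁ v₂), skew₁ v₂ v₂]
  have hv₂ : ∀ y, b v₂ (A₁ (A₂ y)) = 0 := fun y => by rw [skew₁₂, h₂₂]; simp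
  let f : Fin 7 → V := ![A₁ p, A₁ q, A₁ x, A₁ (A₂ p), A₁ (A₂ q), A₁ v₂, A₂ x]
  have hf : LinearIndependent ℝ f := by
    rw [Fintype.linearIndependent_iff]
    intro g hg
    have test : ∀ y, ∑ i, g i * b y (f i) = 0 := fun y => by
      simpa [map_sum, map_smul] using congrArg (b y) hg
    simp only [Fin.sum_univ_seven, f] at test
    -- These vectors make the pairing matrix triangular up to order: `A₂ q`, `A₂ p`, `v₁` isolate
    -- coefficients 0, 1, 6; then `v₂` gives 2, `x` gives 5, and `q`, `p` give 3, 4.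
    have t1 := test (A₂ q)
    have t2 := test (A₂ p)
    have t3 := test v₂
    have t4 := test q
    have t5 := test p
    have t6 := test x
    have t7 := test v₁
    simp [skew₂, sq₂, anti, h₂₂, sq₁₂, hx, hx', hxv', hv, hv', hv₁, hvv, hv₂, hqp, hpq, hxv]
      at t1 t2 t3 t4 t5 t6 t7
    simp only [t1, t2, t7, zero_mul, zero_add, add_zero, neg_eq_zero, mul_eq_zero, hxv,
      or_false] at t3 t4 t5 t6
    simp only [t3, zero_mul, zero_add, mul_eq_zero, hxv, or_false] at t4 t5 t6
    simp only [t6, zero_mul, add_zero, neg_eq_zero, mul_eq_zero, hpq, or_false] at t4 t5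
    intro i
    fin_cases i <;> assumption
  refine ⟨Submodule.span ℝ (Set.range f), ?_, ?_⟩
  · simpa using finrank_span_eq_card hf
  -- Vectors in the range of `A₁` are mutually orthogonal since `A₁² = 0`; `A₂ x` is orthogonal to
  -- them since `A₁ A₂ x = 0`.
  · have hij : ∀ i j, b (f i) (f j) = 0 := by
      intro i j
      fin_cases i <;> fin_cases j <;>
      simp [f, skew₁, skew₂, sq₁, sq₂, anti, h₂₂, hx, hx']
    have hle : Submodule.span ℝ (Set.range f) ≤ b.orthogonal (Submodule.span ℝ (Set.range f)) := by
      rw [Submodule.span_le]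
      rintro _ ⟨j, rfl⟩ y hy
      induction hy using Submodule.span_induction with
      | mem y hy => obtain ⟨i, rfl⟩ := hy; exact hij i j
      | zero => simp
      | add y z _ _ hy hz => exact (by rw [map_add, LinearMap.add_apply, hy, hz, add_zero] :
          b (y + z) (f j) = 0)
      | smul c y _ hy => exact (by rw [map_smul, LinearMap.smul_apply, hy, smul_zero] :
          b (c • y) (f j) = 0)
    exact fun y hy => hle hy y hy

/-! ### Consequences of a transitive centralizer. -/

section Displacement

variable {n : ℕ} {b : BilinForm ℝ (Fin n → ℝ)} {Γ : Subgroup (Iso b)}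

/-- The nilpotent part of the linear part of an affine automorphism. -/
def nilpart (γ : Iso b) : (Fin n → ℝ) →ₗ[ℝ] (Fin n → ℝ) :=
  (γ : (Fin n → ℝ) ≃ᵃ[ℝ] (Fin n → ℝ)).linear.toLinearMap - LinearMap.id

theorem iso_apply (γ : Iso b) (x : Fin n → ℝ) :
    (γ : (Fin n → ℝ) ≃ᵃ[ℝ] (Fin n → ℝ)) x
      = x + (nilpart γ x + (γ : (Fin n → ℝ) ≃ᵃ[ℝ] (Fin n → ℝ)) 0) := by
  have h := (γ : (Fin n → ℝ) ≃ᵃ[ℝ] (Fin n → ℝ)).map_vadd 0 x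
  simp only [vadd_eq_add, add_zero] at h
  rw [h]
  simp [nilpart]
  abel

theorem centralizer_apply_comm {z γ : Iso b} (hz : z ∈ Subgroup.centralizer (Γ : Set (Iso b)))
    (hγ : γ ∈ Γ) (x : Fin n → ℝ) :
    (γ : (Fin n → ℝ) ≃ᵃ[ℝ] (Fin n → ℝ)) ((z : (Fin n → ℝ) ≃ᵃ[ℝ] (Fin n → ℝ)) x)
      = (z : (Fin n → ℝ) ≃ᵃ[ℝ] (Fin n → ℝ)) ((γ : (Fin n → ℝ) ≃ᵃ[ℝ] (Fin n → ℝ)) x) := by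
  have h := Subgroup.mem_centralizer_iff.1 hz γ hγ
  exact congrArg (fun δ : Iso b => (δ : (Fin n → ℝ) ≃ᵃ[ℝ] (Fin n → ℝ)) x) h

/-- The pairing of the displacement vectors of two elements of `Γ` does not depend on the base
point. -/
theorem displacement_pairing_const (hΓ : HasTransitiveCentralizer Γ) {γ δ : Iso b} (hγ : γ ∈ Γ)
    (hδ : δ ∈ Γ) (x : Fin n → ℝ) :
    b (nilpart γ x + (γ : (Fin n → ℝ) ≃ᵃ[ℝ] (Fin n → ℝ)) 0)
      (nilpart δ x + (δ : (Fin n → ℝ) ≃ᵃ[ℝ] (Fin n → ℝ)) 0)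
      = b ((γ : (Fin n → ℝ) ≃ᵃ[ℝ] (Fin n → ℝ)) 0) ((δ : (Fin n → ℝ) ≃ᵃ[ℝ] (Fin n → ℝ)) 0) := by
  obtain ⟨z, hz, rfl⟩ := hΓ 0 x
  have key : ∀ {γ : Iso b}, γ ∈ Γ →
      nilpart γ ((z : (Fin n → ℝ) ≃ᵃ[ℝ] (Fin n → ℝ)) 0)
        + (γ : (Fin n → ℝ) ≃ᵃ[ℝ] (Fin n → ℝ)) 0
      = (z : (Fin n → ℝ) ≃ᵃ[ℝ] (Fin n → ℝ)).linear
          ((γ : (Fin n → ℝ) ≃ᵃ[ℝ] (Fin n → ℝ)) 0) := by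
    intro γ hγ
    have h₁ := iso_apply γ ((z : (Fin n → ℝ) ≃ᵃ[ℝ] (Fin n → ℝ)) 0)
    have h₂ := (z : (Fin n → ℝ) ≃ᵃ[ℝ] (Fin n → ℝ)).map_vadd 0
      ((γ : (Fin n → ℝ) ≃ᵃ[ℝ] (Fin n → ℝ)) 0)
    rw [centralizer_apply_comm hz hγ] at h₁
    simp only [vadd_eq_add, add_zero] at h₂
    rw [h₂, add_comm] at h₁
    exact (add_left_cancel h₁).symm
  rw [key hγ, key hδ]
  exact z.2 _ _

/-- Agreement at one point spreads along the orbit of the centralizer, which is everything. -/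
theorem eq_of_apply_eq (hΓ : HasTransitiveCentralizer Γ) {γ δ : Iso b} (hγ : γ ∈ Γ) (hδ : δ ∈ Γ)
    {x : Fin n → ℝ} (h : (γ : (Fin n → ℝ) ≃ᵃ[ℝ] (Fin n → ℝ)) x
      = (δ : (Fin n → ℝ) ≃ᵃ[ℝ] (Fin n → ℝ)) x) : γ = δ := by
  apply Subtype.ext
  apply AffineEquiv.ext
  intro y
  obtain ⟨z, hz, rfl⟩ := hΓ x y
  rw [centralizer_apply_comm hz hγ, centralizer_apply_comm hz hδ, h]

variable (hb : b.IsSymm) (hnd : b.Nondegenerate) (hΓ : HasTransitiveCentralizer Γ) {γ δ : Iso b}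
  (hγ : γ ∈ Γ) (hδ : δ ∈ Γ)

-- These are the quadratic and linear terms of a constant polynomial in `x`, separated by comparing
-- `x` with `-x`.
include hΓ hγ hδ in
theorem nilpart_pairing (x : Fin n → ℝ) : b (nilpart γ x) (nilpart δ x) = 0 ∧
    b (nilpart γ x) ((δ : (Fin n → ℝ) ≃ᵃ[ℝ] (Fin n → ℝ)) 0)
      + b ((γ : (Fin n → ℝ) ≃ᵃ[ℝ] (Fin n → ℝ)) 0) (nilpart δ x) = 0 := by
  have h₁ := displacement_pairing_const hΓ hγ hδ x
  have h₂ := displacement_pairing_const hΓ hγ hδ (-x)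
  simp only [map_neg, map_add, LinearMap.add_apply, LinearMap.neg_apply] at h₁ h₂
  constructor <;> linarith

include hb hΓ hγ hδ in
theorem nilpart_pairing_polar (x y : Fin n → ℝ) :
    b (nilpart γ x) (nilpart δ y) + b (nilpart δ x) (nilpart γ y) = 0 := by
  have h₁ := (nilpart_pairing hΓ hγ hδ (x + y)).1
  have h₂ := (nilpart_pairing hΓ hγ hδ x).1
  have h₃ := (nilpart_pairing hΓ hγ hδ y).1
  have h₄ := hb.eq (nilpart δ x) (nilpart γ y)
  simp only [map_add, LinearMap.add_apply] at *
  linarith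

include hb hΓ hγ in
theorem nilpart_isotropic (x y : Fin n → ℝ) : b (nilpart γ x) (nilpart γ y) = 0 := by
  linarith [nilpart_pairing_polar hb hΓ hγ hγ x y]

include hb hΓ hγ in
theorem nilpart_skew (x y : Fin n → ℝ) : b (nilpart γ x) y = -b x (nilpart γ y) := by
  have h₁ : b (nilpart γ x + x) (nilpart γ y + y) = b x y := by
    simpa [nilpart] using γ.2 x y
  have h₂ := nilpart_isotropic hb hΓ hγ x y
  simp only [map_add, LinearMap.add_apply] at h₁
  linarith

include hb hnd hΓ hγ hδ in
theorem nilpart_anticomm (x : Fin n → ℝ) :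
    nilpart δ (nilpart γ x) = -nilpart γ (nilpart δ x) := by
  rw [eq_neg_iff_add_eq_zero]
  refine hnd.1 _ fun y => ?_
  rw [map_add, LinearMap.add_apply, nilpart_skew hb hΓ hγ, nilpart_skew hb hΓ hδ]
  linarith [nilpart_pairing_polar hb hΓ hγ hδ x y]

include hb hnd hΓ hγ in
theorem nilpart_sq (x : Fin n → ℝ) : nilpart γ (nilpart γ x) = 0 := by
  refine hnd.1 _ fun y => ?_
  rw [nilpart_skew hb hΓ hγ, nilpart_isotropic hb hΓ hγ, neg_zero]

include hb hnd hΓ hγ hδ in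
theorem nilpart_translation : nilpart γ ((δ : (Fin n → ℝ) ≃ᵃ[ℝ] (Fin n → ℝ)) 0)
    = -nilpart δ ((γ : (Fin n → ℝ) ≃ᵃ[ℝ] (Fin n → ℝ)) 0) := by
  rw [eq_neg_iff_add_eq_zero]
  refine hnd.2 _ fun y => ?_
  have h₁ := (nilpart_pairing hΓ hγ hδ y).2
  have h₂ := nilpart_skew hb hΓ hγ y ((δ : (Fin n → ℝ) ≃ᵃ[ℝ] (Fin n → ℝ)) 0)
  have h₃ := nilpart_skew hb hΓ hδ y ((γ : (Fin n → ℝ) ≃ᵃ[ℝ] (Fin n → ℝ)) 0)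
  have h₄ := hb.eq ((γ : (Fin n → ℝ) ≃ᵃ[ℝ] (Fin n → ℝ)) 0) (nilpart δ y)
  simp only [map_add] at *
  linarith

end Displacement

/-! ### The lower bound. -/

theorem seven_le_of_nonabelian_holonomy {n s : ℕ} (hs : 2 * s ≤ n) (b : BilinForm ℝ (Fin n → ℝ))
    (hb : IsPseudoEuclidean s b) (Γ : Subgroup (Iso b)) (hΓ : HasTransitiveCentralizer Γ)
    (hol : HasNonabelianHolonomy Γ) : 7 ≤ s := by
  obtain ⟨_, ⟨γ, hγ, rfl⟩, _, ⟨δ, hδ, rfl⟩, hne⟩ := hol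
  have hγδ : γ * δ ≠ δ * γ := by
    intro h
    apply hne
    rw [← map_mul, ← map_mul, h]
  have self : ∀ {γ : Iso b}, γ ∈ Γ →
      nilpart γ ((γ : (Fin n → ℝ) ≃ᵃ[ℝ] (Fin n → ℝ)) 0) = 0 := fun {γ} hγ => by
    have h := nilpart_translation hb.symm hb.nondegenerate hΓ hγ hγ
    exact self_eq_neg.1 h
  have anti := nilpart_anticomm hb.symm hb.nondegenerate hΓ hγ hδ
  have trans := nilpart_translation hb.symm hb.nondegenerate hΓ hγ hδ
  obtain ⟨N, hN, hiso⟩ := exists_isotropic_submodule_finrank_eq_seven b hb.symm hb.nondegenerate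
    (nilpart γ) (nilpart δ) ((γ : (Fin n → ℝ) ≃ᵃ[ℝ] (Fin n → ℝ)) 0)
    ((δ : (Fin n → ℝ) ≃ᵃ[ℝ] (Fin n → ℝ)) 0)
    (nilpart_skew hb.symm hΓ hγ) (nilpart_skew hb.symm hΓ hδ)
    (nilpart_sq hb.symm hb.nondegenerate hΓ hγ) (nilpart_sq hb.symm hb.nondegenerate hΓ hδ)
    anti (self hγ) (self hδ) (nilpart_translation hb.symm hb.nondegenerate hΓ hδ hγ)
    (by
      -- `γδ` and `δγ` differ at `t` by `2 (A₁ A₂ t + A₁ v₂)`; if this vanished, freeness would give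
      -- `γδ = δγ`.
      intro t ht
      refine hγδ (eq_of_apply_eq hΓ (mul_mem hγ hδ) (mul_mem hδ hγ) (x := t) ?_)
      simp only [Subgroup.coe_mul, AffineEquiv.coe_mul, Function.comp_apply]
      rw [iso_apply γ (_ : Fin n → ℝ), iso_apply δ t,
        iso_apply δ ((γ : (Fin n → ℝ) ≃ᵃ[ℝ] (Fin n → ℝ)) t), iso_apply γ t]
      simp only [map_add]
      rw [anti t]
      linear_combination 2 * ht - trans)
    (by
      by_contra! h
      apply hne
      ext1 x
      have key : ∀ γ : Iso b, ∀ y, (γ : (Fin n → ℝ) ≃ᵃ[ℝ] (Fin n → ℝ)).linear y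
        = y + nilpart γ y := fun γ y => by simp [nilpart]
      change (γ : (Fin n → ℝ) ≃ᵃ[ℝ] (Fin n → ℝ)).linear
        ((δ : (Fin n → ℝ) ≃ᵃ[ℝ] (Fin n → ℝ)).linear x)
        = (δ : (Fin n → ℝ) ≃ᵃ[ℝ] (Fin n → ℝ)).linear
        ((γ : (Fin n → ℝ) ≃ᵃ[ℝ] (Fin n → ℝ)).linear x)
      simp only [key, map_add, anti, h, neg_zero]
      abel)
  have h := QuadraticForm.sigPos_add_finrank_le_of_nonpos
    (Q := LinearMap.BilinMap.toQuadraticMap b) (V := N) fun x hx => (hiso x hx).le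
  rw [hN, hb.sigPos_eq, Module.finrank_fin_fun] at h
  -- `2 * s ≤ n` keeps the natural subtraction `n - s` from truncating.
  omega

/-! ### The example in dimension 14. -/

/-- The affine isometry with linear part `L` that maps the origin to `v`. -/
noncomputable def affineIsometry {n : ℕ} {b : BilinForm ℝ (Fin n → ℝ)} (hnd : b.Nondegenerate)
    (L : (Fin n → ℝ) →ₗ[ℝ] (Fin n → ℝ)) (hL : ∀ x y, b (L x) (L y) = b x y) (v : Fin n → ℝ) :
    Iso b :=
  ⟨AffineEquiv.ofLinearEquiv (LinearEquiv.ofInjectiveEndo L (by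
      rw [← LinearMap.ker_eq_bot, LinearMap.ker_eq_bot']
      intro x hx
      refine hnd.1 x fun y => ?_
      rw [← hL, hx, map_zero, LinearMap.zero_apply])) 0 v, fun x y => by
    rw [AffineEquiv.linear_ofLinearEquiv]
    exact hL x y⟩

theorem affineIsometry_apply {n : ℕ} {b : BilinForm ℝ (Fin n → ℝ)} (hnd : b.Nondegenerate)
    (L : (Fin n → ℝ) →ₗ[ℝ] (Fin n → ℝ)) (hL : ∀ x y, b (L x) (L y) = b x y) (v x : Fin n → ℝ) :
    (affineIsometry hnd L hL v : (Fin n → ℝ) ≃ᵃ[ℝ] (Fin n → ℝ)) x = L x + v := by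
  simp [affineIsometry]

theorem affineIsometry_linear_apply {n : ℕ} {b : BilinForm ℝ (Fin n → ℝ)} (hnd : b.Nondegenerate)
    (L : (Fin n → ℝ) →ₗ[ℝ] (Fin n → ℝ)) (hL : ∀ x y, b (L x) (L y) = b x y) (v x : Fin n → ℝ) :
    (affineIsometry hnd L hL v : (Fin n → ℝ) ≃ᵃ[ℝ] (Fin n → ℝ)).linear x = L x := by
  simp [affineIsometry]

theorem affineIsometry_commute {n : ℕ} {b : BilinForm ℝ (Fin n → ℝ)} (hnd : b.Nondegenerate)
    {L M : (Fin n → ℝ) →ₗ[ℝ] (Fin n → ℝ)} (hL : ∀ x y, b (L x) (L y) = b x y)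
    (hM : ∀ x y, b (M x) (M y) = b x y) {v w : Fin n → ℝ} (hLM : ∀ x, L (M x) = M (L x))
    (hvw : L w + v = M v + w) :
    affineIsometry hnd L hL v * affineIsometry hnd M hM w
      = affineIsometry hnd M hM w * affineIsometry hnd L hL v := by
  apply Subtype.ext
  apply AffineEquiv.ext
  intro x
  simp only [Subgroup.coe_mul, AffineEquiv.coe_mul, Function.comp_apply, affineIsometry_apply,
    map_add, hLM, add_assoc, hvw]

/-- The split form on `ℝ¹⁴`, with hyperbolic pairs `(eᵢ, eᵢ₊₇)`. -/
noncomputable def splitForm : BilinForm ℝ (Fin 14 → ℝ) :=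
  LinearMap.mk₂ ℝ (fun u w => u 0 * w 7 + u 7 * w 0 + u 1 * w 8 + u 8 * w 1 + u 2 * w 9 + u 9 * w 2
      + u 3 * w 10 + u 10 * w 3 + u 4 * w 11 + u 11 * w 4 + u 5 * w 12 + u 12 * w 5
      + u 6 * w 13 + u 13 * w 6)
    (fun _ _ _ => by simp only [Pi.add_apply]; ring)
    (fun _ _ _ => by simp only [Pi.smul_apply, smul_eq_mul]; ring)
    (fun _ _ _ => by simp only [Pi.add_apply]; ring)
    (fun _ _ _ => by simp only [Pi.smul_apply, smul_eq_mul]; ring)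

theorem splitForm_apply (u w : Fin 14 → ℝ) : splitForm u w =
    u 0 * w 7 + u 7 * w 0 + u 1 * w 8 + u 8 * w 1 + u 2 * w 9 + u 9 * w 2
      + u 3 * w 10 + u 10 * w 3 + u 4 * w 11 + u 11 * w 4 + u 5 * w 12 + u 12 * w 5
      + u 6 * w 13 + u 13 * w 6 := rfl

theorem splitForm_isSymm : splitForm.IsSymm := ⟨fun u w => by
  simp only [splitForm_apply]; ring⟩

theorem splitForm_nondegenerate : splitForm.Nondegenerate := by
  have left : ∀ u, (∀ w, splitForm u w = 0) → u = 0 := by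
    intro u hu
    ext i
    -- Addition in `Fin 14` wraps around, so `i + 7` is the hyperbolic partner of every `i`.
    have h : splitForm u (Pi.single (i + 7) 1) = u i := by
      fin_cases i <;> simp [splitForm_apply]
    rw [← h, hu, Pi.zero_apply]
  refine ⟨left, fun w hw => left w fun u => ?_⟩
  rw [← hw u]
  exact splitForm_isSymm.eq w u

theorem exists_isotropic_splitForm :
    ∃ N : Submodule ℝ (Fin 14 → ℝ), Module.finrank ℝ N = 7 ∧ ∀ x ∈ N, splitForm x x = 0 := by
  let f : (Fin 7 → ℝ) →ₗ[ℝ] (Fin 14 → ℝ) :=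
    { toFun := fun u => ![u 0, u 1, u 2, u 3, u 4, u 5, u 6, 0, 0, 0, 0, 0, 0, 0]
      map_add' := fun u w => by simp
      map_smul' := fun c u => by simp }
  refine ⟨LinearMap.range f, ?_, ?_⟩
  · rw [LinearMap.finrank_range_of_inj, Module.finrank_fin_fun]
    intro u w h
    ext i
    fin_cases i
    exacts [congrFun h 0, congrFun h 1, congrFun h 2, congrFun h 3, congrFun h 4, congrFun h 5,
      congrFun h 6]
  · rintro _ ⟨u, rfl⟩
    simp [splitForm_apply, f]

/-- An isotropic 7-space bounds both indices by 7, and they sum to 14 because the radical is zero.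
-/
theorem isPseudoEuclidean_splitForm : IsPseudoEuclidean 7 splitForm := by
  obtain ⟨N, hN, hiso⟩ := exists_isotropic_splitForm
  have hpos := QuadraticForm.sigPos_add_finrank_le_of_nonpos
    (Q := LinearMap.BilinMap.toQuadraticMap splitForm) (V := N) fun x hx => (hiso x hx).le
  have hneg := QuadraticForm.sigPos_add_finrank_le_of_nonpos
    (Q := -LinearMap.BilinMap.toQuadraticMap splitForm) (V := N) fun x hx =>
      (neg_eq_zero.2 (hiso x hx)).le
  have hsum := QuadraticForm.sigPos_add_sigNeg_add_radical
    (Q := LinearMap.BilinMap.toQuadraticMap splitForm)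
  have hrad : (LinearMap.BilinMap.toQuadraticMap splitForm).radical = ⊥ := by
    rw [Submodule.eq_bot_iff]
    intro u hu
    obtain ⟨hu₀, hu₁⟩ := QuadraticMap.mem_radical_iff'.1 hu
    refine splitForm_nondegenerate.1 u fun w => ?_
    have h := hu₁ w
    have hsymm : splitForm u w = splitForm w u := splitForm_isSymm.eq u w
    simp only [LinearMap.BilinMap.toQuadraticMap_apply, map_add, LinearMap.add_apply] at h hu₀
    linarith
  rw [hrad, finrank_bot, Module.finrank_fin_fun] at hsum
  rw [sigPos_neg, hN, Module.finrank_fin_fun] at hneg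
  rw [hN, Module.finrank_fin_fun] at hpos
  exact ⟨splitForm_isSymm, splitForm_nondegenerate, by omega, by omega⟩

/-- The linear part of the first generator. -/
def unipotentA : (Fin 14 → ℝ) →ₗ[ℝ] (Fin 14 → ℝ) where
  toFun u := ![u 0, u 1, u 2, u 3, u 4, u 5 + u 0, u 6 + u 1, u 7 - u 12, u 8 - u 13, u 9 + u 4,
    u 10, u 11 - u 2, u 12, u 13]
  map_add' u w := by ext i; fin_cases i <;> simp <;> ring
  map_smul' c u := by ext i; fin_cases i <;> simp <;> ring

/-- The linear part of the second generator. -/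
def unipotentB : (Fin 14 → ℝ) →ₗ[ℝ] (Fin 14 → ℝ) where
  toFun u := ![u 0, u 1, u 2, u 3, u 4, u 5, u 6, u 7 + u 6, u 8 - u 5, u 9 - u 3,
    u 10 + u 2, u 11, u 12 + u 1, u 13 - u 0]
  map_add' u w := by ext i; fin_cases i <;> simp <;> ring
  map_smul' c u := by ext i; fin_cases i <;> simp <;> ring

/-- The linear part of an affine isometry that centralizes both generators and maps the origin
to `t`. -/
def centralizing (t : Fin 14 → ℝ) : (Fin 14 → ℝ) →ₗ[ℝ] (Fin 14 → ℝ) where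
  -- Commuting with the generators, whose translations are `e₃` and `e₄`, forces `e₃ ↦ e₃ + A t` and
  -- `e₄ ↦ e₄ + B t`, where `A`, `B` are the nilpotent parts of the generators. The other entries
  -- make the map an isometry that commutes with both linear parts.
  toFun u := ![u 0, u 1, u 2 + t 1 * u 0 - t 0 * u 1, u 3, u 4, u 5 + t 0 * u 3, u 6 + t 1 * u 3,
    u 7 - t 12 * u 3 + t 6 * u 4 - t 1 * u 9, u 8 - t 13 * u 3 - t 5 * u 4 + t 0 * u 9,
    u 9 + t 4 * u 3 - t 3 * u 4,
    u 10 + (t 12 - t 1 * t 4) * u 0 + (t 13 + t 0 * t 4) * u 1 - t 4 * u 2 + t 2 * u 4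
      - t 1 * u 13 - t 0 * u 12,
    u 11 - (t 6 - t 1 * t 3) * u 0 + (t 5 - t 0 * t 3) * u 1 + t 3 * u 2 - t 2 * u 3
      - t 1 * u 5 + t 0 * u 6,
    u 12 + t 1 * u 4, u 13 - t 0 * u 4]
  map_add' u w := by ext i; fin_cases i <;> simp <;> ring
  map_smul' c u := by ext i; fin_cases i <;> simp <;> ring

theorem unipotentA_isometry (u w : Fin 14 → ℝ) :
    splitForm (unipotentA u) (unipotentA w) = splitForm u w := by
  simp [splitForm_apply, unipotentA]
  ring

theorem unipotentB_isometry (u w : Fin 14 → ℝ) :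
    splitForm (unipotentB u) (unipotentB w) = splitForm u w := by
  simp [splitForm_apply, unipotentB]
  ring

theorem centralizing_isometry (t u w : Fin 14 → ℝ) :
    splitForm (centralizing t u) (centralizing t w) = splitForm u w := by
  simp [splitForm_apply, centralizing]
  ring

theorem unipotentA_centralizing (t u : Fin 14 → ℝ) :
    unipotentA (centralizing t u) = centralizing t (unipotentA u) := by
  ext i
  fin_cases i <;> simp [unipotentA, centralizing] <;> ring

theorem unipotentB_centralizing (t u : Fin 14 → ℝ) :
    unipotentB (centralizing t u) = centralizing t (unipotentB u) := by
  ext i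
  fin_cases i <;> simp [unipotentB, centralizing] <;> ring

theorem unipotentA_translation (t : Fin 14 → ℝ) :
    unipotentA t + Pi.single 3 1 = centralizing t (Pi.single 3 1) + t := by
  ext i
  fin_cases i <;> simp [unipotentA, centralizing] <;> ring

theorem unipotentB_translation (t : Fin 14 → ℝ) :
    unipotentB t + Pi.single 4 1 = centralizing t (Pi.single 4 1) + t := by
  ext i
  fin_cases i <;> simp [unipotentB, centralizing] <;> ring

theorem exists_transitive_centralizer_nonabelian_holonomy :
    ∃ Γ : Subgroup (Iso splitForm), HasTransitiveCentralizer Γ ∧ HasNonabelianHolonomy Γ := by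
  have hnd := splitForm_nondegenerate
  set γ := affineIsometry hnd unipotentA unipotentA_isometry (Pi.single 3 1) with hγ
  set δ := affineIsometry hnd unipotentB unipotentB_isometry (Pi.single 4 1) with hδ
  refine ⟨Subgroup.closure {γ, δ}, ?_, ?_⟩
  · have key : ∀ t : Fin 14 → ℝ, ∃ z ∈ Subgroup.centralizer
        (Subgroup.closure {γ, δ} : Set (Iso splitForm)),
        (z : (Fin 14 → ℝ) ≃ᵃ[ℝ] (Fin 14 → ℝ)) 0 = t := by
      intro t
      refine ⟨affineIsometry hnd (centralizing t) (centralizing_isometry t) t, ?_, ?_⟩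
      · rw [Subgroup.centralizer_closure, Subgroup.mem_centralizer_iff]
        rintro _ (rfl | rfl)
        · exact affineIsometry_commute hnd _ _ (unipotentA_centralizing t)
            (unipotentA_translation t)
        · exact affineIsometry_commute hnd _ _ (unipotentB_centralizing t)
            (unipotentB_translation t)
      · rw [affineIsometry_apply, map_zero, zero_add]
    intro x y
    obtain ⟨z, hz, hzx⟩ := key x
    obtain ⟨w, hw, hwy⟩ := key y
    refine ⟨w * z⁻¹, mul_mem hw (inv_mem hz), ?_⟩
    have hzx' : ((z : (Fin 14 → ℝ) ≃ᵃ[ℝ] (Fin 14 → ℝ)))⁻¹ x = 0 := by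
      rw [← hzx]
      exact AffineEquiv.symm_apply_apply _ _
    rw [Subgroup.coe_mul, AffineEquiv.coe_mul, Function.comp_apply, Subgroup.coe_inv, hzx', hwy]
  · refine ⟨_, ⟨γ, Subgroup.subset_closure (Or.inl rfl), rfl⟩, _,
      ⟨δ, Subgroup.subset_closure (Or.inr rfl), rfl⟩, fun h => ?_⟩
    have h' : (γ : (Fin 14 → ℝ) ≃ᵃ[ℝ] (Fin 14 → ℝ)).linear
        ((δ : (Fin 14 → ℝ) ≃ᵃ[ℝ] (Fin 14 → ℝ)).linear (Pi.single 0 1))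
        = (δ : (Fin 14 → ℝ) ≃ᵃ[ℝ] (Fin 14 → ℝ)).linear
        ((γ : (Fin 14 → ℝ) ≃ᵃ[ℝ] (Fin 14 → ℝ)).linear (Pi.single 0 1)) :=
      LinearEquiv.congr_fun h (Pi.single 0 1)
    rw [hγ, hδ] at h'
    simp only [affineIsometry_linear_apply] at h'
    -- `A B e₀ = e₈` while `B A e₀ = -e₈`, so coordinate 8 tells the two products apart.
    have h8 := congrFun h' 8
    simp [unipotentA, unipotentB] at h8
    linarith

/-- The bounds `s ≥ 7` and `n ≥ 14`, together with their sharpness (both are attained by one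
group). -/
theorem theorem3p10 :
    (∀ (n s : ℕ), 2 * s ≤ n →
      ∀ b : LinearMap.BilinForm ℝ (Fin n → ℝ), IsPseudoEuclidean s b →
      ∀ Γ : Subgroup (Iso b), HasTransitiveCentralizer Γ → HasNonabelianHolonomy Γ →
        7 ≤ s ∧ 14 ≤ n) ∧
    (∃ b : LinearMap.BilinForm ℝ (Fin 14 → ℝ), IsPseudoEuclidean 7 b ∧
      ∃ Γ : Subgroup (Iso b), HasTransitiveCentralizer Γ ∧ HasNonabelianHolonomy Γ) := by
  refine ⟨fun n s hs b hb Γ hΓ hol => ?_, splitForm, isPseudoEuclidean_splitForm,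
    exists_transitive_centralizer_nonabelian_holonomy⟩
  have h := seven_le_of_nonabelian_holonomy hs b hb Γ hΓ hol
  exact ⟨h, by omega⟩
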